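/- **Conventions.** A prederivator is a strict 2-functor $\mathbb D:\mathrm{Cat}^{\mathrm{op}}\to\mathrm{CAT}$ from small categories to categories, reversing functors ($u:I\to J$ gives $u^*:\mathbb D(J)\to\mathbb D(I)$) and preserving the direction of natural transformations. It is a derivator if: (Der1) $\mathbb D(\coprod_i I_i)\to\prod_i\mathbb D(I_i)$ is an equivalence for every small family $(I_i)$ of small categories; (Der2) a morphism $f$ of $\mathbb D(J)$ is invertible as soon as $j^*f$ is invertible in $\mathbb D(e)$ for every object $j:e\to J$, where $e$ is the terminal category; (Der3) every $u^*$ has a left adjoint $u_!$ and a right adjoint $u_*$; (Der4) for $u:J\to K$ and $k\in K$, the base change morphisms $\pi_!\,p^*\to k^*u_!$ (for $p:u/k\to J$, $\pi:u/k\to e$) and $k^*u_*\to\pi_*\,p^*$ (for $p:k/u\to J$, $\pi:k/u\to e$) are invertible. A strict morphism of prederivators is a strict 2-natural transformation; an isomorphism is an invertible strict morphism. For a small category $L$, $\mathbb D^L$ is the prederivator $I\mapsto\mathbb D(L\times I)$. A strict morphism $\varphi:\mathbb D\to\mathbb D'$ is a strong equivalence if there is a strict morphism $\psi:\mathbb D'\to\mathbb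 D$ such that $\psi\varphi$ and $\varphi\psi$ are connected to the identities by finite zigzags of elementary homotopies, an elementary homotopy between $\varphi_0,\varphi_1:\mathbb D\to\mathbb D'$ being a strict morphism $H:\mathbb D\to\mathbb D'^{[1]}$ that restricts to $\varphi_0$ and $\varphi_1$ at the two objects of $[1]=\{0\to1\}$ and whose values have invertible underlying morphism $0^*H(X)\to1^*H(X)$. Let $\mathcal M$ be a (locally small) category with a class $\mathcal W$ of morphisms. For a small category $I$ let $\mathcal W^I$ be the class of morphisms of $\mathcal M^I$ that are objectwise in $\mathcal W$, and let $\mathrm{HO}(\mathcal M,\mathcal W)$ be the prederivator $I\mapsto\mathcal M^I[(\mathcal W^I)^{-1}]$. The pair $(\mathcal M,\mathcal W)$ *induces a derivator* if all the localizations $\mathcal M^I[(\mathcal W^I)^{-1}]$ have small hom-sets and $\mathrm{HO}(\mathcal M,\mathcal W)$ is a derivator. **Proposition.** Suppose that $(\mathcal M,\mathcal W)$ induces a derivator $\mathbb D=\mathrm{HO}(\mathcal M,\mathcal W)$, and let $L$ be a small category. Then $(\mathcal M^L,\mathcal W^L)$ induces a derivator, $\mathbb D^L$ is a derivator, and there is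 an isomorphism of derivators $\varphi:\mathrm{HO}(\mathcal M^L,\mathcal W^L)\to\mathbb D^L$, which is moreover a strong equivalence. This isomorphism is the canonical one: for every small category $I$, the functor $\varphi_I$ composed with the localization functor $(\mathcal M^L)^I\to\mathrm{HO}(\mathcal M^L,\mathcal W^L)(I)$ equals the exponential law $(\mathcal M^L)^I\cong\mathcal M^{L\times I}$ followed by the localization functor $\mathcal M^{L\times I}\to\mathbb D(L\times I)$. -/

import Mathlib

open CategoryTheory

universe w v v₁ v₂ u u₁ u₂

/-- A prederivator: a strict 2-functor from small categories to categories that reverses the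
direction of functors and keeps the direction of natural transformations. The category attached
to `I` is `D.obj I`, the functor attached to `F : I ⥤ J` is `D.map F : D.obj J ⥤ D.obj I`, and the
natural transformation attached to `α : F ⟶ G` is `D.map₂ α : D.map F ⟶ D.map G`. -/
structure Prederivator : Type (max (w + 1) (v + 1) (u + 1)) where
  obj (I : Type w) [SmallCategory I] : Type u
  cat (I : Type w) [SmallCategory I] : Category.{v} (obj I)
  map {I J : Type w} [SmallCategory I] [SmallCategory J] (F : I ⥤ J) : obj J ⥤ obj I
  map₂ {I J : Type w} [SmallCategory I] [SmallCategory J] {F G : I ⥤ J} (α : F ⟶ G) :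
    map F ⟶ map G
  map_id (I : Type w) [SmallCategory I] : map (𝟭 I) = 𝟭 (obj I)
  map_comp {I J K : Type w} [SmallCategory I] [SmallCategory J] [SmallCategory K]
    (F : I ⥤ J) (G : J ⥤ K) : map (F ⋙ G) = map G ⋙ map F
  map₂_id {I J : Type w} [SmallCategory I] [SmallCategory J] (F : I ⥤ J) :
    map₂ (𝟙 F) = 𝟙 (map F)
  map₂_comp {I J : Type w} [SmallCategory I] [SmallCategory J] {F G H : I ⥤ J}
    (α : F ⟶ G) (β : G ⟶ H) : map₂ (α ≫ β) = map₂ α ≫ map₂ β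
  map₂_whiskerLeft {I J K : Type w} [SmallCategory I] [SmallCategory J] [SmallCategory K]
    (F : I ⥤ J) {G H : J ⥤ K} (α : G ⟶ H) :
    map₂ (Functor.whiskerLeft F α) =
      eqToHom (map_comp F G) ≫ Functor.whiskerRight (map₂ α) (map F) ≫
        eqToHom (map_comp F H).symm
  map₂_whiskerRight {I J K : Type w} [SmallCategory I] [SmallCategory J] [SmallCategory K]
    {F G : I ⥤ J} (α : F ⟶ G) (H : J ⥤ K) :
    map₂ (Functor.whiskerRight α H) =
      eqToHom (map_comp F H) ≫ Functor.whiskerLeft (map H) (map₂ α) ≫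
        eqToHom (map_comp G H).symm

namespace Prederivator

attribute [instance] Prederivator.cat

/-- The one-object category `e` with only its identity morphism. -/
abbrev Pt : Type w := Discrete PUnit.{w + 1}

/-- The functor `e ⥤ K` selecting the object `k`. -/
abbrev pt {K : Type w} [SmallCategory K] (k : K) : Pt.{w} ⥤ K := Functor.fromPUnit k

/-- A strict morphism of prederivators: a strict 2-natural transformation. -/
@[ext]
structure StrictHom (D D' : Prederivator.{w, v, u}) where
  app (I : Type w) [SmallCategory I] : D.obj I ⥤ D'.obj I
  naturality {I J : Type w} [SmallCategory I] [SmallCategory J] (F : I ⥤ J) :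
    D.map F ⋙ app I = app J ⋙ D'.map F
  naturality₂ {I J : Type w} [SmallCategory I] [SmallCategory J] {F G : I ⥤ J} (α : F ⟶ G) :
    Functor.whiskerRight (D.map₂ α) (app I) =
      eqToHom (naturality F) ≫ Functor.whiskerLeft (app J) (D'.map₂ α) ≫
        eqToHom (naturality G).symm

/-- Prederivators and strict morphisms form a category; its isomorphisms are the strict
isomorphisms of prederivators. -/
instance : Category Prederivator.{w, v, u} where
  Hom := StrictHom
  id D :=
    { app := fun I => 𝟭 (D.obj I)
      naturality := fun _ => rfl
      naturality₂ := fun α => by ext; simp }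
  comp {D D' D''} φ ψ :=
    { app := fun I => φ.app I ⋙ ψ.app I
      naturality := fun {I J} _ _ F => by
        rw [← Functor.assoc, φ.naturality, Functor.assoc, ψ.naturality, Functor.assoc]
      naturality₂ := fun {I J} _ _ F G α => by
        ext X
        have h₁ := congrArg (fun t => (ψ.app I).map t) (NatTrans.congr_app (φ.naturality₂ α) X)
        have h₂ := NatTrans.congr_app (ψ.naturality₂ α) ((φ.app J).obj X)
        simp only [Functor.whiskerRight_app, Functor.whiskerLeft_app, NatTrans.comp_app,
          eqToHom_app, Functor.map_comp, eqToHom_map, Functor.comp_map] at h₁ h₂ ⊢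
        rw [h₁, h₂]
        simp }

variable (D : Prederivator.{w, v, u})

/-- The 2-cell `F^* ⋙ P^* ⟶ G^* ⋙ Q^*` obtained from a 2-cell `P ⋙ F ⟶ Q ⋙ G`. -/
def square {A I J K : Type w} [SmallCategory A] [SmallCategory I] [SmallCategory J]
    [SmallCategory K] {P : A ⥤ I} {F : I ⥤ K} {Q : A ⥤ J} {G : J ⥤ K} (α : P ⋙ F ⟶ Q ⋙ G) :
    TwoSquare (D.map F) (D.map G) (D.map P) (D.map Q) :=
  TwoSquare.mk _ _ _ _ (eqToHom (D.map_comp P F).symm ≫ D.map₂ α ≫ eqToHom (D.map_comp Q G))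

/-- The axioms of a derivator. -/
structure IsDerivator : Prop where
  /-- Coproducts of small categories are sent to products, up to equivalence. -/
  der₁ {ι : Type w} (I : ι → Type w) [∀ i, SmallCategory (I i)] :
    (Functor.pi' fun i => D.map (Sigma.incl (C := I) i)).IsEquivalence
  /-- Isomorphisms are detected on objects of the shape. -/
  der₂ {J : Type w} [SmallCategory J] {X Y : D.obj J} (f : X ⟶ Y)
    (h : ∀ j : J, IsIso ((D.map (pt j)).map f)) : IsIso f
  /-- Homotopy left Kan extensions exist. -/
  der₃_left {J K : Type w} [SmallCategory J] [SmallCategory K] (F : J ⥤ K) :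
    (D.map F).IsRightAdjoint
  /-- Homotopy right Kan extensions exist. -/
  der₃_right {J K : Type w} [SmallCategory J] [SmallCategory K] (F : J ⥤ K) :
    (D.map F).IsLeftAdjoint
  /-- Left Kan extensions are computed pointwise: with `p : F/k ⥤ J` and `π : F/k ⥤ e` the
  projections, the base change morphism `π_! p^* ⟶ k^* F_!` is invertible. -/
  der₄_left {J K : Type w} [SmallCategory J] [SmallCategory K] (F : J ⥤ K) (k : K)
    (lF : D.obj J ⥤ D.obj K) (adjF : lF ⊣ D.map F)
    (lπ : D.obj (Comma F (pt k)) ⥤ D.obj Pt.{w}) (adjπ : lπ ⊣ D.map (Comma.snd F (pt k))) :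
    IsIso ((mateEquiv adjF adjπ).symm (D.square (Comma.natTrans F (pt k)))).natTrans
  /-- Right Kan extensions are computed pointwise: with `p : k/F ⥤ J` and `π : k/F ⥤ e` the
  projections, the base change morphism `k^* F_* ⟶ π_* p^*` is invertible. -/
  der₄_right {J K : Type w} [SmallCategory J] [SmallCategory K] (F : J ⥤ K) (k : K)
    (rF : D.obj J ⥤ D.obj K) (adjF : D.map F ⊣ rF)
    (rπ : D.obj (Comma (pt k) F) ⥤ D.obj Pt.{w}) (adjπ : D.map (Comma.fst (pt k) F) ⊣ rπ) :
    IsIso (mateEquiv adjF adjπ (D.square (Comma.natTrans (pt k) F))).natTrans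

/-- The shift `D^L`, with `D^L(I) = D(L × I)`: the composite of `D` with `L × -`. -/
def shift (L : Type w) [SmallCategory L] : Prederivator.{w, v, u} where
  obj I _ := D.obj (L × I)
  cat I _ := D.cat (L × I)
  map F := D.map ((𝟭 L).prod F)
  map₂ α := D.map₂ (NatTrans.prod (𝟙 (𝟭 L)) α)
  map_id I _ := D.map_id (L × I)
  map_comp F G := by
    refine Eq.trans ?_ (D.map_comp ((𝟭 L).prod F) ((𝟭 L).prod G))
    rfl
  map₂_id F := D.map₂_id ((𝟭 L).prod F)
  map₂_comp α β := by
    rw [← D.map₂_comp]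
    congr 1
    ext X <;> simp [NatTrans.prod]
  map₂_whiskerLeft F _ _ α :=
    D.map₂_whiskerLeft ((𝟭 L).prod F) (NatTrans.prod (𝟙 (𝟭 L)) α)
  map₂_whiskerRight α H :=
    D.map₂_whiskerRight (NatTrans.prod (𝟙 (𝟭 L)) α) ((𝟭 L).prod H)

/-- The category `[1]`, with two objects and one non-identity morphism. -/
abbrev Arr : Type w := ULift.{w} (Fin 2)

/-- The inclusion `I ⥤ [1] × I` at the source (`a = 0`) or at the target (`a = 1`). -/
abbrev inclAt (a : Fin 2) (I : Type w) [SmallCategory I] : I ⥤ Arr.{w} × I :=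
  Prod.sectR (ULift.up a) I

/-- The natural transformation from the inclusion at `0` to the inclusion at `1`. -/
def inclArr (I : Type w) [SmallCategory I] : inclAt 0 I ⟶ inclAt 1 I where
  app x := Prod.mkHom (homOfLE (show (ULift.up 0 : Arr.{w}) ≤ ULift.up 1 from Fin.zero_le 1)) (𝟙 x)
  naturality x y f := by
    refine Prod.hom_ext ?_ ?_
    · exact Subsingleton.elim _ _
    · exact (Category.comp_id f).trans (Category.id_comp f).symm

variable {D} {D' : Prederivator.{w, v, u}}

/-- An elementary homotopy between strict morphisms `φ, ψ : D ⟶ D'`: a strict morphism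
`D ⟶ D'^[1]` whose values are coherent diagrams of isomorphisms, and whose restrictions to the
two ends of `[1]` are `φ` and `ψ`. -/
def ElementaryHomotopic (φ ψ : D ⟶ D') : Prop :=
  ∃ H : D ⟶ D'.shift Arr.{w},
    (∀ (I : Type w) [SmallCategory I],
      (StrictHom.app H I ⋙ D'.map (inclAt 0 I) : D.obj I ⥤ D'.obj I) = StrictHom.app φ I ∧
      (StrictHom.app H I ⋙ D'.map (inclAt 1 I) : D.obj I ⥤ D'.obj I) = StrictHom.app ψ I) ∧
    ∀ (I : Type w) [SmallCategory I] (X : D.obj I),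
      IsIso ((D'.map₂ (inclArr I)).app ((StrictHom.app H I).obj X))

/-- A strict morphism is a strong equivalence if it has a strict morphism as an inverse up to
(chains of) elementary homotopies, that is, if it is a homotopy equivalence for the simplicial
enrichment of prederivators with strict morphisms. -/
def IsStrongEquivalence (φ : D ⟶ D') : Prop :=
  ∃ ψ : D' ⟶ D,
    Relation.EqvGen ElementaryHomotopic (φ ≫ ψ) (𝟙 D) ∧
    Relation.EqvGen ElementaryHomotopic (ψ ≫ φ) (𝟙 D')

end Prederivator

section Localization

variable {M : Type u} [Category.{w} M] (W : MorphismProperty M)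

/-- The functor on localizations of diagram categories induced by precomposition with `F`. -/
noncomputable def hoMap {I J : Type w} [SmallCategory I] [SmallCategory J] (F : I ⥤ J) :
    (W.functorCategory J).Localization ⥤ (W.functorCategory I).Localization :=
  Localization.Construction.lift
    ((Functor.whiskeringLeft I J M).obj F ⋙ (W.functorCategory I).Q)
    (fun _ _ f hf => (W.functorCategory I).Q_inverts
      (((Functor.whiskeringLeft I J M).obj F).map f) (fun i => hf (F.obj i)))

theorem Q_hoMap {I J : Type w} [SmallCategory I] [SmallCategory J] (F : I ⥤ J) :
    (W.functorCategory J).Q ⋙ hoMap W F =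
      (Functor.whiskeringLeft I J M).obj F ⋙ (W.functorCategory I).Q :=
  Localization.Construction.fac _ _

/-- The natural transformation on localizations of diagram categories induced by `α`. -/
noncomputable def hoMap₂ {I J : Type w} [SmallCategory I] [SmallCategory J] {F G : I ⥤ J} (α : F ⟶ G) :
    hoMap W F ⟶ hoMap W G :=
  Localization.Construction.natTransExtension
    (eqToHom (Q_hoMap W F) ≫
      Functor.whiskerRight ((Functor.whiskeringLeft I J M).map α) (W.functorCategory I).Q ≫
      eqToHom (Q_hoMap W G).symm)

theorem hoMap_map_Q {I J : Type w} [SmallCategory I] [SmallCategory J] (F : I ⥤ J)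
    {X Y : J ⥤ M} (f : X ⟶ Y) :
    (hoMap W F).map ((W.functorCategory J).Q.map f) =
      (W.functorCategory I).Q.map (Functor.whiskerLeft F f) := by
  have h := Functor.congr_hom (Q_hoMap W F) f
  refine h.trans ?_
  erw [eqToHom_refl, eqToHom_refl, Category.id_comp, Category.comp_id]
  rfl

theorem hoMap₂_app_Q {I J : Type w} [SmallCategory I] [SmallCategory J] {F G : I ⥤ J}
    (α : F ⟶ G) (X : J ⥤ M) :
    (hoMap₂ W α).app ((W.functorCategory J).Q.obj X) =
      (W.functorCategory I).Q.map (Functor.whiskerRight α X) := by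
  refine (Localization.Construction.NatTransExtension.app_eq _ X).trans ?_
  rw [NatTrans.comp_app, NatTrans.comp_app, eqToHom_app, eqToHom_app]
  erw [eqToHom_refl, eqToHom_refl, Category.id_comp, Category.comp_id]
  rfl

theorem natTrans_ext_Q {C : Type u₁} [Category.{v₁} C] {S : MorphismProperty C} {E : Type u₂}
    [Category.{v₂} E] {F G : S.Localization ⥤ E} {α β : F ⟶ G}
    (h : ∀ X : C, α.app (S.Q.obj X) = β.app (S.Q.obj X)) : α = β := by
  ext X
  obtain ⟨Y, rfl⟩ := (Localization.Construction.objEquiv S).surjective X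
  exact h Y

/-- The prederivator induced by `(M, W)`: it sends `I` to the localization of `I ⥤ M` at the
objectwise weak equivalences. -/
noncomputable def HO : Prederivator.{w, max u w, max u w} where
  obj I _ := (W.functorCategory I).Localization
  cat I _ := inferInstance
  map F := hoMap W F
  map₂ α := hoMap₂ W α
  map_id I _ := Localization.Construction.uniq _ _ (Q_hoMap W (𝟭 I))
  map_comp {I J K} _ _ _ F G := by
    apply Localization.Construction.uniq
    rw [Q_hoMap, ← Functor.assoc, Q_hoMap, Functor.assoc, Q_hoMap]
    rfl
  map₂_id F := by
    apply natTrans_ext_Q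
    intro X
    rw [hoMap₂_app_Q, Functor.whiskerRight_id']
    exact (W.functorCategory _).Q.map_id _
  map₂_comp α β := by
    apply natTrans_ext_Q
    intro X
    rw [NatTrans.comp_app, hoMap₂_app_Q, hoMap₂_app_Q, hoMap₂_app_Q,
      Functor.whiskerRight_comp]
    exact (W.functorCategory _).Q.map_comp _ _
  map₂_whiskerLeft F G H α := by
    apply natTrans_ext_Q
    intro X
    rw [NatTrans.comp_app, NatTrans.comp_app, eqToHom_app, eqToHom_app,
      Functor.whiskerRight_app, hoMap₂_app_Q, hoMap₂_app_Q]
    erw [hoMap_map_Q, eqToHom_refl, eqToHom_refl, Category.id_comp, Category.comp_id]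
    rfl
  map₂_whiskerRight α H := by
    apply natTrans_ext_Q
    intro X
    rw [NatTrans.comp_app, NatTrans.comp_app, eqToHom_app, eqToHom_app,
      Functor.whiskerLeft_app, hoMap₂_app_Q]
    erw [eqToHom_refl, eqToHom_refl, Category.id_comp, Category.comp_id]
    exact (hoMap₂_app_Q W α (H ⋙ X)).symm

/-- The localization functor from `I`-shaped diagrams to the value of `HO W` at `I`. -/
noncomputable def HO.Q (I : Type w) [SmallCategory I] : (I ⥤ M) ⥤ (HO W).obj I := (W.functorCategory I).Q

/-- `(M, W)` induces a derivator: each localization of a diagram category has small hom-sets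
(it is a category, in the sense that requires hom-sets), and the resulting prederivator is a
derivator. -/
structure InducesDerivator : Prop where
  locallySmall (I : Type w) [SmallCategory I] :
    LocallySmall.{w} (W.functorCategory I).Localization
  isDerivator : (HO W).IsDerivator

end Localization

/-- The exponential law `(M^L)^I ⥤ M^(L × I)`, sending `X` to `(l, i) ↦ X(i)(l)`. -/
def expLaw (L I : Type w) [SmallCategory L] [SmallCategory I] (M : Type u) [Category.{v} M] :
    (I ⥤ L ⥤ M) ⥤ (L × I ⥤ M) :=
  flipFunctor I L M ⋙ Functor.uncurry

/-! The exponential law is an isomorphism of categories that matches the weak equivalences of both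
sides, so by the strict universal property of localization it descends to isomorphisms between
localizations (`hoExp`, `hoExpInv`). Uniqueness in that property also gives strict compatibility
with restriction functors. A strict isomorphism is a strong equivalence with constant zigzags, and
it transports the derivator axioms (`StrictHom.isDerivator`). What remains is that a shift of a
derivator is a derivator (`IsDerivator.shift`).

For the shift, only Der4 is more than a reindexing. The comma square of `F : J ⥤ K` at `k`,
multiplied by `L`, is no longer a comma square at an object. By Der2 its base change morphism may be
tested at each `(l, *)` of `L × e`. Pasting with the comma square of `L × F/k ⥤ L × e` at `(l, *)`
gives, up to an equivalence of shapes, the comma square of `L × F` at `(l, k)`. Der4 for `D` applies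
to the pasted piece and to the whole, and two-out-of-three for mates yields the claim. -/

namespace CategoryTheory.TwoSquare

/-! ### Calculus of mates: base change, pasting and cancellation. -/

section

universe v₃ v₄ v₅ v₆ u₃ u₄ u₅ u₆

variable {A : Type u₁} {B : Type u₂} {C : Type u₃} {D : Type u₄} {E : Type u₅} {F : Type u₆}
  [Category.{v₁} A] [Category.{v₂} B] [Category.{v₃} C]
  [Category.{v₄} D] [Category.{v₅} E] [Category.{v₆} F]

/-- A square `R₁ ⋙ G ⟶ H ⋙ R₂` satisfies left base change if its mate `G ⋙ L₂ ⟶ L₁ ⋙ H` is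
invertible, for all left adjoints `L₁` of `R₁` and `L₂` of `R₂`. -/
def LeftBaseChange {R₁ : B ⥤ A} {H : B ⥤ D} {G : A ⥤ C} {R₂ : D ⥤ C}
    (s : TwoSquare R₁ H G R₂) : Prop :=
  ∀ (L₁ : A ⥤ B) (adj₁ : L₁ ⊣ R₁) (L₂ : C ⥤ D) (adj₂ : L₂ ⊣ R₂),
    IsIso ((mateEquiv adj₁ adj₂).symm s).natTrans

/-- A square `G ⋙ L₂ ⟶ L₁ ⋙ H` satisfies right base change if its mate `R₁ ⋙ G ⟶ H ⋙ R₂` is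
invertible, for all right adjoints `R₁` of `L₁` and `R₂` of `L₂`. -/
def RightBaseChange {G : A ⥤ C} {L₁ : A ⥤ B} {L₂ : C ⥤ D} {H : B ⥤ D}
    (s : TwoSquare G L₁ L₂ H) : Prop :=
  ∀ (R₁ : B ⥤ A) (adj₁ : L₁ ⊣ R₁) (R₂ : D ⥤ C) (adj₂ : L₂ ⊣ R₂),
    IsIso (mateEquiv adj₁ adj₂ s).natTrans

/-- By Yoneda: transposed along both adjunctions, precomposition with the mate becomes "apply `G`,
then compose with `s`", which is bijective. -/
theorem leftBaseChange_of_isEquivalence {R₁ : B ⥤ A} {H : B ⥤ D} {G : A ⥤ C} {R₂ : D ⥤ C}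
    (s : TwoSquare R₁ H G R₂) [H.IsEquivalence] [G.IsEquivalence] (hs : IsIso s.natTrans) :
    s.LeftBaseChange := by
  intro L₁ adj₁ L₂ adj₂
  rw [NatTrans.isIso_iff_isIso_app]
  intro c
  rw [isIso_iff_coyoneda_map_bijective]
  intro T
  have h (d : B) (g : L₁.obj c ⟶ d) :
      adj₂.homEquiv _ _ (((mateEquiv adj₁ adj₂).symm s).app c ≫ H.map g) =
        G.map (adj₁.homEquiv _ _ g) ≫ s.natTrans.app d := by
    have e := unit_mateEquiv_symm adj₁ adj₂ s c
    rw [Adjunction.homEquiv_unit, Adjunction.homEquiv_unit, Functor.map_comp, Functor.map_comp,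
      Category.assoc]
    refine (Category.assoc _ _ _).symm.trans ?_
    refine (congrArg (· ≫ R₂.map (H.map g)) e.symm).trans ?_
    refine (Category.assoc _ _ _).trans ?_
    exact congrArg (G.map (adj₁.unit.app c) ≫ ·) (s.natTrans.naturality g).symm
  -- Essential surjectivity of `H` reduces to test objects `H.obj d`, and full faithfulness to test
  -- maps `H.map g`, the only ones that `h` handles.
  obtain ⟨d, ⟨i⟩⟩ : ∃ d, Nonempty (H.obj d ≅ T) := ⟨_, ⟨H.objObjPreimageIso T⟩⟩
  have hb : Function.Bijective fun x : H.obj (L₁.obj c) ⟶ H.obj d =>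
      ((mateEquiv adj₁ adj₂).symm s).app c ≫ x := by
    have e₁ : Function.Bijective fun g : L₁.obj c ⟶ d =>
        adj₂.homEquiv _ _ (((mateEquiv adj₁ adj₂).symm s).app c ≫ H.map g) := by
      simp_rw [h]
      have e₂ : Function.Bijective fun y : G.obj c ⟶ G.obj (R₁.obj d) => y ≫ s.natTrans.app d :=
        ((asIso (s.natTrans.app d)).homToEquiv).bijective
      have e₃ : Function.Bijective fun y : c ⟶ R₁.obj d => G.map y :=
        (Functor.FullyFaithful.ofFullyFaithful G).map_bijective _ _
      exact e₂.comp (e₃.comp (adj₁.homEquiv _ _).bijective)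
    have e₄ := (Equiv.comp_bijective _ (adj₂.homEquiv _ _)).1 e₁
    exact (Function.Bijective.of_comp_iff _
      ((Functor.FullyFaithful.ofFullyFaithful H).map_bijective _ _)).1 e₄
  have e₅ := (i.homToEquiv (X := _)).bijective.comp (hb.comp (i.symm.homToEquiv).bijective)
  refine (iff_of_eq (congrArg Function.Bijective (funext fun x => ?_))).1 e₅
  simp

theorem rightBaseChange_of_isEquivalence {G : A ⥤ C} {L₁ : A ⥤ B} {L₂ : C ⥤ D} {H : B ⥤ D}
    (s : TwoSquare G L₁ L₂ H) [G.IsEquivalence] [H.IsEquivalence] (hs : IsIso s.natTrans) :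
    s.RightBaseChange := by
  intro R₁ adj₁ R₂ adj₂
  rw [NatTrans.isIso_iff_isIso_app]
  intro d
  rw [isIso_iff_yoneda_map_bijective]
  intro T
  have h (c : A) (g : c ⟶ R₁.obj d) :
      (adj₂.homEquiv _ _).symm (G.map g ≫ (mateEquiv adj₁ adj₂ s).app d) =
        s.natTrans.app c ≫ H.map ((adj₁.homEquiv _ _).symm g) := by
    have e := mateEquiv_counit adj₁ adj₂ s d
    rw [Adjunction.homEquiv_counit, Adjunction.homEquiv_counit, Functor.map_comp,
      Functor.map_comp]
    refine (Category.assoc _ _ _).trans ?_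
    refine (congrArg (L₂.map (G.map g) ≫ ·) e).trans ?_
    refine (Category.assoc _ _ _).symm.trans ?_
    refine Eq.trans ?_ (Category.assoc _ _ _)
    exact congrArg (· ≫ H.map (adj₁.counit.app d)) (s.natTrans.naturality g)
  obtain ⟨c, ⟨i⟩⟩ : ∃ c, Nonempty (G.obj c ≅ T) := ⟨_, ⟨G.objObjPreimageIso T⟩⟩
  have hb : Function.Bijective fun x : G.obj c ⟶ G.obj (R₁.obj d) =>
      x ≫ (mateEquiv adj₁ adj₂ s).app d := by
    have e₁ : Function.Bijective fun g : c ⟶ R₁.obj d =>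
        (adj₂.homEquiv _ _).symm (G.map g ≫ (mateEquiv adj₁ adj₂ s).app d) := by
      simp_rw [h]
      have e₂ : Function.Bijective fun y : H.obj (L₁.obj c) ⟶ H.obj d =>
          s.natTrans.app c ≫ y :=
        ((asIso (s.natTrans.app c)).symm.homFromEquiv).bijective
      have e₃ : Function.Bijective fun y : L₁.obj c ⟶ d => H.map y :=
        (Functor.FullyFaithful.ofFullyFaithful H).map_bijective _ _
      exact e₂.comp (e₃.comp (adj₁.homEquiv _ _).symm.bijective)
    have e₄ := (Equiv.comp_bijective _ (adj₂.homEquiv _ _).symm).1 e₁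
    exact (Function.Bijective.of_comp_iff _
      ((Functor.FullyFaithful.ofFullyFaithful G).map_bijective _ _)).1 e₄
  have e₅ := (i.homFromEquiv).bijective.comp (hb.comp (i.symm.homFromEquiv).bijective)
  refine (iff_of_eq (congrArg Function.Bijective (funext fun x => ?_))).1 e₅
  simp

section

variable {R₁ : B ⥤ A} {R₂ : D ⥤ C} {R₃ : F ⥤ E} {G₁ : A ⥤ C} {G₂ : C ⥤ E} {H₁ : B ⥤ D}
  {H₂ : D ⥤ F} {s : TwoSquare R₁ H₁ G₁ R₂} {t : TwoSquare R₂ H₂ G₂ R₃}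

/-- The mate of a pasting is a composite of the two mates; this is the source of every
two-out-of-three statement below. -/
theorem mateEquiv_symm_vComp_app {L₁ : A ⥤ B} {L₂ : C ⥤ D} {L₃ : E ⥤ F} (adj₁ : L₁ ⊣ R₁)
    (adj₂ : L₂ ⊣ R₂) (adj₃ : L₃ ⊣ R₃) (s : TwoSquare R₁ H₁ G₁ R₂) (t : TwoSquare R₂ H₂ G₂ R₃)
    (X : A) :
    ((mateEquiv adj₁ adj₃).symm (s.vComp t)).natTrans.app X =
      ((mateEquiv adj₂ adj₃).symm t).natTrans.app (G₁.obj X) ≫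
        H₂.map (((mateEquiv adj₁ adj₂).symm s).natTrans.app X) := by
  have h : (mateEquiv adj₁ adj₃).symm (s.vComp t) =
      ((mateEquiv adj₁ adj₂).symm s).hComp ((mateEquiv adj₂ adj₃).symm t) := by
    rw [Equiv.symm_apply_eq, mateEquiv_vcomp adj₁ adj₂ adj₃, Equiv.apply_symm_apply,
      Equiv.apply_symm_apply]
  rw [h]
  simp [hComp]

theorem LeftBaseChange.vComp [R₂.IsRightAdjoint] (hs : s.LeftBaseChange)
    (ht : t.LeftBaseChange) : (s.vComp t).LeftBaseChange := by
  intro L₁ adj₁ L₃ adj₃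
  rw [NatTrans.isIso_iff_isIso_app]
  intro X
  rw [mateEquiv_symm_vComp_app adj₁ (Adjunction.ofIsRightAdjoint R₂)]
  have := hs _ adj₁ _ (Adjunction.ofIsRightAdjoint R₂)
  have := ht _ (Adjunction.ofIsRightAdjoint R₂) _ adj₃
  infer_instance

/-- Without conservativity of `H₂` only the image of the mate is known to be invertible. This
suffices for Der4 of a shift, where `H₂` is evaluation at an object and Der2 gathers all
evaluations. -/
theorem LeftBaseChange.isIso_map [R₃.IsRightAdjoint] (ht : t.LeftBaseChange)
    (hst : (s.vComp t).LeftBaseChange) {L₁ : A ⥤ B} {L₂ : C ⥤ D} (adj₁ : L₁ ⊣ R₁)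
    (adj₂ : L₂ ⊣ R₂) (X : A) :
    IsIso (H₂.map (((mateEquiv adj₁ adj₂).symm s).natTrans.app X)) := by
  have := hst _ adj₁ _ (Adjunction.ofIsRightAdjoint R₃)
  have := ht _ adj₂ _ (Adjunction.ofIsRightAdjoint R₃)
  have h := mateEquiv_symm_vComp_app adj₁ adj₂ (Adjunction.ofIsRightAdjoint R₃) s t X
  exact IsIso.of_isIso_fac_left h.symm

theorem LeftBaseChange.of_vComp_left [R₃.IsRightAdjoint] [H₂.IsEquivalence]
    (ht : t.LeftBaseChange) (hst : (s.vComp t).LeftBaseChange) : s.LeftBaseChange := by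
  intro L₁ adj₁ L₂ adj₂
  rw [NatTrans.isIso_iff_isIso_app]
  intro X
  have := ht.isIso_map hst adj₁ adj₂ X
  exact isIso_of_reflects_iso _ H₂

/-- The composite formula controls the mate of `t` only at objects `G₁.obj X`; up to isomorphism
these are all objects. -/
theorem LeftBaseChange.of_vComp_right [R₁.IsRightAdjoint] [G₁.IsEquivalence]
    (hs : s.LeftBaseChange) (hst : (s.vComp t).LeftBaseChange) : t.LeftBaseChange := by
  intro L₂ adj₂ L₃ adj₃
  have := hst _ (Adjunction.ofIsRightAdjoint R₁) _ adj₃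
  have := hs _ (Adjunction.ofIsRightAdjoint R₁) _ adj₂
  have h (X : A) := mateEquiv_symm_vComp_app (Adjunction.ofIsRightAdjoint R₁) adj₂ adj₃ s t X
  have h' (X : A) : IsIso (((mateEquiv adj₂ adj₃).symm t).natTrans.app (G₁.obj X)) :=
    IsIso.of_isIso_fac_right (h X).symm
  rw [NatTrans.isIso_iff_isIso_app]
  intro Y
  exact (NatTrans.isIso_app_iff_of_iso ((mateEquiv adj₂ adj₃).symm t).natTrans
    (G₁.objObjPreimageIso Y)).1 (h' _)

/-- Needed because strict functoriality, such as `map_comp`, equates the edges of two squares only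
propositionally. -/
theorem LeftBaseChange.congr {H₁' : B ⥤ D} {G₁' : A ⥤ C} {s' : TwoSquare R₁ H₁' G₁' R₂}
    (hs : s.LeftBaseChange) (hH : H₁' = H₁) (hG : G₁' = G₁)
    (h : ∀ X, s'.natTrans.app X = eqToHom (by rw [hG]) ≫ s.natTrans.app X ≫
      eqToHom (by rw [hH])) : s'.LeftBaseChange := by
  subst hH hG
  obtain rfl : s' = s := TwoSquare.ext _ _ fun X => by simpa using h X
  exact hs

end

section

variable {L₁ : A ⥤ B} {L₂ : C ⥤ D} {L₃ : E ⥤ F} {G₁ : A ⥤ C} {G₂ : C ⥤ E} {H₁ : B ⥤ D}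
  {H₂ : D ⥤ F} {s : TwoSquare G₁ L₁ L₂ H₁} {t : TwoSquare G₂ L₂ L₃ H₂}

/-- Dual of `mateEquiv_symm_vComp_app`; the same cancellations follow for right adjoints. -/
theorem mateEquiv_hComp_app {R₁ : B ⥤ A} {R₂ : D ⥤ C} {R₃ : F ⥤ E} (adj₁ : L₁ ⊣ R₁)
    (adj₂ : L₂ ⊣ R₂) (adj₃ : L₃ ⊣ R₃) (s : TwoSquare G₁ L₁ L₂ H₁) (t : TwoSquare G₂ L₂ L₃ H₂)
    (X : B) :
    (mateEquiv adj₁ adj₃ (s.hComp t)).natTrans.app X =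
      G₂.map ((mateEquiv adj₁ adj₂ s).natTrans.app X) ≫
        (mateEquiv adj₂ adj₃ t).natTrans.app (H₁.obj X) := by
  rw [mateEquiv_vcomp adj₁ adj₂ adj₃]
  simp [TwoSquare.vComp, -mateEquiv_apply]

theorem RightBaseChange.hComp [L₂.IsLeftAdjoint] (hs : s.RightBaseChange)
    (ht : t.RightBaseChange) : (s.hComp t).RightBaseChange := by
  intro R₁ adj₁ R₃ adj₃
  rw [NatTrans.isIso_iff_isIso_app]
  intro X
  rw [mateEquiv_hComp_app adj₁ (Adjunction.ofIsLeftAdjoint L₂)]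
  have := hs _ adj₁ _ (Adjunction.ofIsLeftAdjoint L₂)
  have := ht _ (Adjunction.ofIsLeftAdjoint L₂) _ adj₃
  infer_instance

theorem RightBaseChange.isIso_map [L₃.IsLeftAdjoint] (ht : t.RightBaseChange)
    (hst : (s.hComp t).RightBaseChange) {R₁ : B ⥤ A} {R₂ : D ⥤ C} (adj₁ : L₁ ⊣ R₁)
    (adj₂ : L₂ ⊣ R₂) (X : B) :
    IsIso (G₂.map ((mateEquiv adj₁ adj₂ s).natTrans.app X)) := by
  have := hst _ adj₁ _ (Adjunction.ofIsLeftAdjoint L₃)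
  have := ht _ adj₂ _ (Adjunction.ofIsLeftAdjoint L₃)
  have h := mateEquiv_hComp_app adj₁ adj₂ (Adjunction.ofIsLeftAdjoint L₃) s t X
  exact IsIso.of_isIso_fac_right h.symm

theorem RightBaseChange.of_hComp_left [L₃.IsLeftAdjoint] [G₂.IsEquivalence]
    (ht : t.RightBaseChange) (hst : (s.hComp t).RightBaseChange) : s.RightBaseChange := by
  intro R₁ adj₁ R₂ adj₂
  rw [NatTrans.isIso_iff_isIso_app]
  intro X
  have := ht.isIso_map hst adj₁ adj₂ X
  exact isIso_of_reflects_iso _ G₂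

theorem RightBaseChange.of_hComp_right [L₁.IsLeftAdjoint] [H₁.IsEquivalence]
    (hs : s.RightBaseChange) (hst : (s.hComp t).RightBaseChange) : t.RightBaseChange := by
  intro R₂ adj₂ R₃ adj₃
  have := hst _ (Adjunction.ofIsLeftAdjoint L₁) _ adj₃
  have := hs _ (Adjunction.ofIsLeftAdjoint L₁) _ adj₂
  have h (X : B) := mateEquiv_hComp_app (Adjunction.ofIsLeftAdjoint L₁) adj₂ adj₃ s t X
  have h' (X : B) : IsIso ((mateEquiv adj₂ adj₃ t).natTrans.app (H₁.obj X)) :=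
    IsIso.of_isIso_fac_left (h X).symm
  rw [NatTrans.isIso_iff_isIso_app]
  intro Y
  exact (NatTrans.isIso_app_iff_of_iso (mateEquiv adj₂ adj₃ t).natTrans
    (H₁.objObjPreimageIso Y)).1 (h' _)

theorem RightBaseChange.congr {G₁' : A ⥤ C} {H₁' : B ⥤ D} {s' : TwoSquare G₁' L₁ L₂ H₁'}
    (hs : s.RightBaseChange) (hG : G₁' = G₁) (hH : H₁' = H₁)
    (h : ∀ X, s'.natTrans.app X = eqToHom (by rw [hG]) ≫ s.natTrans.app X ≫
      eqToHom (by rw [hH])) : s'.RightBaseChange := by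
  subst hH hG
  obtain rfl : s' = s := TwoSquare.ext _ _ fun X => by simpa using h X
  exact hs

end

end
end CategoryTheory.TwoSquare

/-! ### Squares in a prederivator and invariance of the derivator axioms. -/

namespace Prederivator

open CategoryTheory.TwoSquare

section

variable (D : Prederivator.{w, v, u})

theorem square_app {A I J K : Type w} [SmallCategory A] [SmallCategory I] [SmallCategory J]
    [SmallCategory K] {P : A ⥤ I} {F : I ⥤ K} {Q : A ⥤ J} {G : J ⥤ K} (α : P ⋙ F ⟶ Q ⋙ G)
    (X : D.obj K) :
    (D.square α).natTrans.app X =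
      eqToHom (by rw [D.map_comp]) ≫ (D.map₂ α).app X ≫ eqToHom (by rw [D.map_comp]) := by
  refine Eq.trans (NatTrans.comp_app _ _ X) ?_
  rw [NatTrans.comp_app, eqToHom_app, eqToHom_app]

section

variable {A B I J J' K : Type w} [SmallCategory A] [SmallCategory B] [SmallCategory I]
  [SmallCategory J] [SmallCategory J'] [SmallCategory K]
  {P : A ⥤ I} {F : I ⥤ K} {Q : A ⥤ J} {G : J ⥤ K} (α : P ⋙ F ⟶ Q ⋙ G)

/-- By 2-functoriality, pasting the images of two 2-cells is the image of their pasting, up to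
`eqToHom`. -/
theorem leftBaseChange_vComp_square {R : B ⥤ A} {S : B ⥤ J'} {H : J' ⥤ J} (β : R ⋙ Q ⟶ S ⋙ H)
    (h : (D.square (P := R ⋙ P) (F := F) (Q := S) (G := H ⋙ G)
      (Functor.whiskerLeft R α ≫ Functor.whiskerRight β G)).LeftBaseChange) :
    ((D.square α).vComp (D.square β)).LeftBaseChange := by
  refine h.congr (D.map_comp H G).symm (D.map_comp R P).symm fun X => ?_
  rw [square_app]
  have e : D.map₂ (F := (R ⋙ P) ⋙ F) (G := S ⋙ H ⋙ G)
      (Functor.whiskerLeft R α ≫ Functor.whiskerRight β G) =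
        D.map₂ (Functor.whiskerLeft R α) ≫ D.map₂ (Functor.whiskerRight β G) :=
    D.map₂_comp _ _
  rw [e, D.map₂_whiskerLeft, D.map₂_whiskerRight]
  simp [vComp, square_app, eqToHom_map]

theorem rightBaseChange_hComp_square {R : B ⥤ J'} {H : J' ⥤ I} {S : B ⥤ A} (β : R ⋙ H ⟶ S ⋙ P)
    (h : (D.square (P := R) (F := H ⋙ F) (Q := S ⋙ Q) (G := G)
      (Functor.whiskerRight β F ≫ Functor.whiskerLeft S α)).RightBaseChange) :
    ((D.square α).hComp (D.square β)).RightBaseChange := by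
  refine h.congr (D.map_comp H F).symm (D.map_comp S Q).symm fun X => ?_
  rw [square_app]
  have e : D.map₂ (F := R ⋙ H ⋙ F) (G := (S ⋙ Q) ⋙ G)
      (Functor.whiskerRight β F ≫ Functor.whiskerLeft S α) =
        D.map₂ (Functor.whiskerRight β F) ≫ D.map₂ (Functor.whiskerLeft S α) :=
    D.map₂_comp _ _
  rw [e, D.map₂_whiskerLeft, D.map₂_whiskerRight]
  simp [hComp, square_app, eqToHom_map]

end

theorem isEquivalence_map {I J : Type w} [SmallCategory I] [SmallCategory J] (e : I ≌ J) :
    (D.map e.functor).IsEquivalence := by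
  have isoOf {A B : Type w} [SmallCategory A] [SmallCategory B] {F G : A ⥤ B} (i : F ≅ G) :
      Nonempty (D.map F ≅ D.map G) :=
    ⟨⟨D.map₂ i.hom, D.map₂ i.inv, by rw [← D.map₂_comp, i.hom_inv_id, D.map₂_id],
      by rw [← D.map₂_comp, i.inv_hom_id, D.map₂_id]⟩⟩
  obtain ⟨η⟩ := isoOf e.counitIso
  obtain ⟨ε⟩ := isoOf e.unitIso
  -- Functors are reversed, so the counit of `e` supplies the unit of the new equivalence, and the
  -- unit its counit.
  exact (CategoryTheory.Equivalence.mk (D.map e.functor) (D.map e.inverse)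
    (eqToIso (D.map_id J).symm ≪≫ η.symm ≪≫ eqToIso (D.map_comp _ _))
    (eqToIso (D.map_comp _ _).symm ≪≫ ε.symm ≪≫ eqToIso (D.map_id I))).isEquivalence_functor

theorem isIso_square {A I J K : Type w} [SmallCategory A] [SmallCategory I] [SmallCategory J]
    [SmallCategory K] {P : A ⥤ I} {F : I ⥤ K} {Q : A ⥤ J} {G : J ⥤ K} (α : P ⋙ F ⟶ Q ⋙ G)
    [IsIso α] : IsIso (D.square α).natTrans := by
  have : IsIso (D.map₂ α) := ⟨D.map₂ (inv α), by rw [← D.map₂_comp, IsIso.hom_inv_id, D.map₂_id],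
    by rw [← D.map₂_comp, IsIso.inv_hom_id, D.map₂_id]⟩
  dsimp only [square, natTrans, TwoSquare.mk]
  infer_instance

end

section

variable {D D' : Prederivator.{w, v, u}}

/-- The naturality square of a strict morphism. -/
def StrictHom.natSquare (φ : StrictHom D D') {I J : Type w} [SmallCategory I] [SmallCategory J]
    (F : I ⥤ J) : TwoSquare (D.map F) (φ.app J) (φ.app I) (D'.map F) :=
  TwoSquare.mk _ _ _ _ (eqToHom (φ.naturality F))

/-- The naturality square of a strict morphism, in the other direction. -/
def StrictHom.natSquareInv (φ : StrictHom D D') {I J : Type w} [SmallCategory I]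
    [SmallCategory J] (F : I ⥤ J) : TwoSquare (φ.app J) (D.map F) (D'.map F) (φ.app I) :=
  TwoSquare.mk _ _ _ _ (eqToHom (φ.naturality F).symm)

variable (φ : StrictHom D D')

theorem StrictHom.leftBaseChange_natSquare
    (hφ : ∀ (I : Type w) [SmallCategory I], (φ.app I).IsEquivalence)
    {I J : Type w} [SmallCategory I] [SmallCategory J]
    (F : I ⥤ J) : (φ.natSquare F).LeftBaseChange := by
  have := hφ I
  have := hφ J
  exact leftBaseChange_of_isEquivalence _
    (by dsimp only [natSquare, natTrans, TwoSquare.mk]; infer_instance)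

theorem StrictHom.rightBaseChange_natSquareInv
    (hφ : ∀ (I : Type w) [SmallCategory I], (φ.app I).IsEquivalence)
    {I J : Type w} [SmallCategory I] [SmallCategory J]
    (F : I ⥤ J) : (φ.natSquareInv F).RightBaseChange := by
  have := hφ I
  have := hφ J
  exact rightBaseChange_of_isEquivalence _
    (by dsimp only [natSquareInv, natTrans, TwoSquare.mk]; infer_instance)

theorem StrictHom.map₂_map (φ : StrictHom D D') {I J : Type w} [SmallCategory I]
    [SmallCategory J] {F G : I ⥤ J} (α : F ⟶ G) (X : D.obj J) :
    (φ.app I).map ((D.map₂ α).app X) = eqToHom (Functor.congr_obj (φ.naturality F) X) ≫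
      (D'.map₂ α).app ((φ.app J).obj X) ≫ eqToHom (Functor.congr_obj (φ.naturality G) X).symm := by
  have h := NatTrans.congr_app (φ.naturality₂ α) X
  simpa [eqToHom_app] using h

section

variable {A I J K : Type w} [SmallCategory A] [SmallCategory I] [SmallCategory J]
    [SmallCategory K] {P : A ⥤ I} {F : I ⥤ K} {Q : A ⥤ J} {G : J ⥤ K} (α : P ⋙ F ⟶ Q ⋙ G)

/-- The square of `D` pasted with the naturality square of `Q` is the naturality square of `F`
pasted with the square of `D'`. Naturality squares satisfy base change, so the one of `F` can be
cancelled. -/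
theorem StrictHom.leftBaseChange_square
    (hφ : ∀ (I : Type w) [SmallCategory I], (φ.app I).IsEquivalence)
    [(D.map F).IsRightAdjoint] [(D.map Q).IsRightAdjoint]
    (h : (D.square α).LeftBaseChange) : (D'.square α).LeftBaseChange := by
  have := hφ I
  refine (φ.leftBaseChange_natSquare hφ F).of_vComp_right (t := D'.square α) ?_
  refine (h.vComp (φ.leftBaseChange_natSquare hφ Q)).congr (φ.naturality G).symm
    (φ.naturality P).symm fun X => ?_
  simp [TwoSquare.vComp, square_app, eqToHom_map, natSquare, eqToHom_app, φ.map₂_map]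

theorem StrictHom.rightBaseChange_square
    (hφ : ∀ (I : Type w) [SmallCategory I], (φ.app I).IsEquivalence)
    [(D.map G).IsLeftAdjoint] [(D.map P).IsLeftAdjoint]
    (h : (D.square α).RightBaseChange) : (D'.square α).RightBaseChange := by
  have := hφ J
  refine (φ.rightBaseChange_natSquareInv hφ G).of_hComp_right (t := D'.square α) ?_
  refine (h.hComp (φ.rightBaseChange_natSquareInv hφ P)).congr (φ.naturality F).symm
    (φ.naturality Q).symm fun X => ?_
  simp [TwoSquare.hComp, square_app, eqToHom_map, natSquareInv, eqToHom_app, φ.map₂_map]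

end

/-- A strict morphism consisting of equivalences intertwines restriction functors. -/
noncomputable def StrictHom.conjIso
    (hφ : ∀ (I : Type w) [SmallCategory I], (φ.app I).IsEquivalence)
    {J K : Type w} [SmallCategory J] [SmallCategory K] (F : J ⥤ K) :
    have := hφ K
    (φ.app K).inv ⋙ D.map F ⋙ φ.app J ≅ D'.map F :=
  have := hφ K
  Functor.isoWhiskerLeft _ (eqToIso (φ.naturality F)) ≪≫ (Functor.associator _ _ _).symm ≪≫
    Functor.isoWhiskerRight (φ.app K).asEquivalence.counitIso (D'.map F) ≪≫ Functor.leftUnitor _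

theorem StrictHom.isDerivator
    (hφ : ∀ (I : Type w) [SmallCategory I], (φ.app I).IsEquivalence)
    (hD : D.IsDerivator) : D'.IsDerivator where
  der₁ {ι} I _ := by
    have := hφ (Σ i, I i)
    have (i : ι) := hφ (I i)
    have := hD.der₁ I
    have e : φ.app (Σ i, I i) ⋙ Functor.pi' (fun i => D'.map (Sigma.incl (C := I) i)) ≅
        Functor.pi' (fun i => D.map (Sigma.incl (C := I) i)) ⋙
          Functor.pi (fun i => φ.app (I i)) :=
      NatIso.pi' fun i => eqToIso (φ.naturality (Sigma.incl (C := I) i)).symm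
    have := Functor.isEquivalence_of_iso e.symm
    exact Functor.isEquivalence_of_comp_left (φ.app (Σ i, I i)) _
  der₂ {J} _ {X Y} f h := by
    have := hφ J
    have := hφ Pt.{w}
    -- A quasi-inverse carries `f` back to `D`, where Der2 is known; `conjIso` identifies the
    -- restrictions to `j`.
    have : IsIso ((φ.app J).inv.map f) := hD.der₂ _ fun j => by
      have : IsIso ((φ.app Pt.{w}).map ((D.map (pt j)).map ((φ.app J).inv.map f))) :=
        (NatIso.isIso_map_iff (φ.conjIso hφ (pt j)) f).2 (h j)
      exact isIso_of_reflects_iso _ (φ.app Pt.{w})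
    exact isIso_of_reflects_iso f (φ.app J).inv
  der₃_left {J K} _ _ F := by
    have := hφ J
    have := hφ K
    have := hD.der₃_left F
    exact Functor.isRightAdjoint_of_iso (φ.conjIso hφ F)
  der₃_right {J K} _ _ F := by
    have := hφ J
    have := hφ K
    have := hD.der₃_right F
    exact Functor.isLeftAdjoint_of_iso (φ.conjIso hφ F)
  der₄_left {J K} _ _ F k lF adjF lπ adjπ := by
    have := hD.der₃_left F
    have := hD.der₃_left (Comma.snd F (pt k))
    exact φ.leftBaseChange_square (Comma.natTrans F (pt k)) hφ
      (fun _ a _ b => hD.der₄_left F k _ a _ b) _ adjF _ adjπ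
  der₄_right {J K} _ _ F k rF adjF rπ adjπ := by
    have := hD.der₃_right F
    have := hD.der₃_right (Comma.fst (pt k) F)
    exact φ.rightBaseChange_square (Comma.natTrans (pt k) F) hφ
      (fun _ a _ b => hD.der₄_right F k _ a _ b) _ adjF _ adjπ

end

end Prederivator

/-! ### Shifts of derivators. -/

namespace Prederivator

open CategoryTheory.TwoSquare

section

variable (L : Type w) [SmallCategory L]

/-- The product with `L` distributes over coproducts of categories. -/
def sigmaProd {ι : Type w} (I : ι → Type w) [∀ i, SmallCategory (I i)] :
    (Σ i, L × I i) ⥤ L × (Σ i, I i) :=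
  Sigma.desc fun i => (𝟭 L).prod (Sigma.incl i)

/-- Turns Der1 of `D` for the family `L × I i` into Der1 of the shift for the family `I i`. -/
instance isEquivalence_sigmaProd {ι : Type w} (I : ι → Type w) [∀ i, SmallCategory (I i)] :
    (sigmaProd L I).IsEquivalence where
  faithful :=
    { map_injective := by
        rintro ⟨i, l, a⟩ ⟨_, l', b⟩ ⟨f⟩ g h
        change Sigma.SigmaHom _ _ at g
        cases g with
        | mk g =>
          have h : ((𝟭 L).prod (Sigma.incl (C := I) i)).map f =
            ((𝟭 L).prod (Sigma.incl (C := I) i)).map g := h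
          have h₁ : f.1 = g.1 := (Prod.ext_iff.1 h).1
          have h₂ : (Sigma.incl i).map f.2 = (Sigma.incl i).map g.2 := (Prod.ext_iff.1 h).2
          have h₃ := (Sigma.incl i).map_injective h₂
          exact congrArg Sigma.SigmaHom.mk (Prod.ext h₁ h₃) }
  full :=
    { map_surjective := by
        rintro ⟨i, l, a⟩ ⟨j, l', b⟩ ⟨f, g⟩
        change l ⟶ l' at f
        change Sigma.SigmaHom ⟨i, a⟩ ⟨j, b⟩ at g
        cases g with
        | mk g => exact ⟨Sigma.SigmaHom.mk (Prod.mkHom f g), rfl⟩ }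
  essSurj :=
    { mem_essImage := by
        rintro ⟨l, i, a⟩
        exact ⟨⟨i, l, a⟩, ⟨Iso.refl _⟩⟩ }

variable {J K : Type w} [SmallCategory J] [SmallCategory K] (F : J ⥤ K) (k : K)
variable {L}

/-- The comparison from the comma category of `L × F` over `(l, k)` to the comma category of the
projection `L × F/k ⥤ L × e` over `l`. -/
def commaProdLeft (l : L) :
    Comma ((𝟭 L).prod F) (pt (l, k)) ⥤
      Comma ((𝟭 L).prod (Comma.snd F (pt k))) (pt ((l, ⟨⟨⟩⟩) : L × Pt.{w})) where
  obj x :=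
    { left := (x.left.1, { left := x.left.2, right := ⟨⟨⟩⟩, hom := x.hom.2 })
      right := x.right
      hom := Prod.mkHom x.hom.1 (𝟙 _) }
  map {x y} f :=
    { left := Prod.mkHom f.left.1
        { left := f.left.2
          right := 𝟙 _
          w := by
            have h : ((𝟭 L).prod F).map f.left ≫ y.hom = x.hom ≫ 𝟙 _ := f.w
            have h₂ : F.map f.left.2 ≫ y.hom.2 = x.hom.2 ≫ 𝟙 _ := congrArg Prod.snd h
            exact h₂ }
      right := f.right
      w := by
        have h : ((𝟭 L).prod F).map f.left ≫ y.hom = x.hom ≫ 𝟙 _ := f.w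
        have h₁ : f.left.1 ≫ y.hom.1 = x.hom.1 ≫ 𝟙 _ := congrArg Prod.fst h
        exact Prod.ext h₁ (Subsingleton.elim _ _) }

/-- The comparison from the comma category of `L × F` under `(l, k)` to the comma category of the
projection `L × k/F ⥤ L × e` under `l`. -/
def commaProdRight (l : L) :
    Comma (pt (l, k)) ((𝟭 L).prod F) ⥤
      Comma (pt ((l, ⟨⟨⟩⟩) : L × Pt.{w})) ((𝟭 L).prod (Comma.fst (pt k) F)) where
  obj x :=
    { left := x.left
      right := (x.right.1, { left := ⟨⟨⟩⟩, right := x.right.2, hom := x.hom.2 })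
      hom := Prod.mkHom x.hom.1 (𝟙 _) }
  map {x y} f :=
    { left := f.left
      right := Prod.mkHom f.right.1
        { left := 𝟙 _
          right := f.right.2
          w := by
            have h : 𝟙 _ ≫ y.hom = x.hom ≫ ((𝟭 L).prod F).map f.right := f.w
            have h₂ : 𝟙 _ ≫ y.hom.2 = x.hom.2 ≫ F.map f.right.2 := congrArg Prod.snd h
            exact h₂ }
      w := by
        have h : 𝟙 _ ≫ y.hom = x.hom ≫ ((𝟭 L).prod F).map f.right := f.w
        have h₁ : 𝟙 _ ≫ y.hom.1 = x.hom.1 ≫ f.right.1 := congrArg Prod.fst h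
        exact Prod.ext h₁ (Subsingleton.elim _ _) }

/-- Both sides carry the same data, an arrow to `l` and an arrow to `k`; the extra coordinates lie
in `Pt`, where parallel arrows agree. -/
instance (l : L) : (commaProdLeft F k l).IsEquivalence where
  faithful :=
    { map_injective := by
        intro x y f g h
        have h₁ : f.left.1 = g.left.1 := congrArg (fun t => t.left.1) h
        have h₂ : f.left.2 = g.left.2 := congrArg (fun t => t.left.2.left) h
        exact Comma.hom_ext _ _ (Prod.ext h₁ h₂) (Subsingleton.elim _ _) }
  full :=
    { map_surjective := by
        intro x y f
        refine ⟨{ left := Prod.mkHom f.left.1 f.left.2.left, right := f.right, w := ?_ }, ?_⟩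
        · refine Prod.ext ?_ ?_
          · have h := congrArg Prod.fst f.w
            exact h
          · have h := f.left.2.w
            exact h
        · refine Comma.hom_ext _ _ (Prod.ext rfl ?_) (Subsingleton.elim _ _)
          exact Comma.hom_ext _ _ rfl (Subsingleton.elim _ _) }
  essSurj :=
    { mem_essImage := by
        rintro ⟨⟨l', ⟨j, ⟨⟨⟩⟩, h⟩⟩, ⟨⟨⟩⟩, g, g'⟩
        exact ⟨{ left := (l', j), right := ⟨⟨⟩⟩, hom := Prod.mkHom g h }, ⟨Iso.refl _⟩⟩ }

instance (l : L) : (commaProdRight F k l).IsEquivalence where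
  faithful :=
    { map_injective := by
        intro x y f g h
        have h₁ : f.right.1 = g.right.1 := congrArg (fun t => t.right.1) h
        have h₂ : f.right.2 = g.right.2 := congrArg (fun t => t.right.2.right) h
        exact Comma.hom_ext _ _ (Subsingleton.elim _ _) (Prod.ext h₁ h₂) }
  full :=
    { map_surjective := by
        intro x y f
        refine ⟨{ left := f.left, right := Prod.mkHom f.right.1 f.right.2.right, w := ?_ }, ?_⟩
        · refine Prod.ext ?_ ?_
          · have h := congrArg Prod.fst f.w
            exact h
          · have h := f.right.2.w
            exact h
        · refine Comma.hom_ext _ _ (Subsingleton.elim _ _) (Prod.ext rfl ?_)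
          exact Comma.hom_ext _ _ (Subsingleton.elim _ _) rfl }
  essSurj :=
    { mem_essImage := by
        rintro ⟨⟨⟨⟩⟩, ⟨l', ⟨⟨⟨⟩⟩, j, h⟩⟩, g, g'⟩
        exact ⟨{ left := ⟨⟨⟩⟩, right := (l', j), hom := Prod.mkHom g h }, ⟨Iso.refl _⟩⟩ }

variable {D : Prederivator.{w, v, u}}

/-- Two-out-of-three: the square pasted below and the total pasting both come from comma squares at
objects, so Der4 of `D` covers them. -/
theorem IsDerivator.leftBaseChange_shift_comma (hD : D.IsDerivator) (L : Type w)
    [SmallCategory L] {lF : D.obj (L × J) ⥤ D.obj (L × K)} (adjF : lF ⊣ D.map ((𝟭 L).prod F))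
    {lπ : D.obj (L × Comma F (pt k)) ⥤ D.obj (L × Pt.{w})}
    (adjπ : lπ ⊣ D.map ((𝟭 L).prod (Comma.snd F (pt k)))) (c : L × Pt.{w}) (X : D.obj (L × J)) :
    IsIso ((D.map (pt c)).map (((mateEquiv adjF adjπ).symm
      (D.square (P := (𝟭 L).prod (Comma.fst F (pt k))) (F := (𝟭 L).prod F)
        (Q := (𝟭 L).prod (Comma.snd F (pt k))) (G := (𝟭 L).prod (pt k))
        (NatTrans.prod (𝟙 (𝟭 L)) (Comma.natTrans F (pt k))))).natTrans.app X)) := by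
  obtain ⟨l, ⟨⟨⟩⟩⟩ := c
  let Q := (𝟭 L).prod (Comma.snd F (pt k))
  let G := (𝟭 L).prod F
  have := hD.der₃_left (Comma.snd Q (pt ((l, ⟨⟨⟩⟩) : L × Pt.{w})))
  have := hD.der₃_left (Comma.snd G (pt (l, k)))
  have : (D.map (commaProdLeft F k l)).IsEquivalence :=
    D.isEquivalence_map (commaProdLeft F k l).asEquivalence
  have : (D.map (𝟭 Pt.{w})).IsEquivalence :=
    D.isEquivalence_map (CategoryTheory.Equivalence.refl (C := Pt.{w}))
  -- The comparison of shapes, viewed as a commuting square with an equivalence on one side and an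
  -- identity on the other, so that it can be pasted on and cancelled.
  let γ : commaProdLeft F k l ⋙ Comma.snd Q (pt ((l, ⟨⟨⟩⟩) : L × Pt.{w})) ⟶
    Comma.snd G (pt (l, k)) ⋙ 𝟭 Pt.{w} := 𝟙 (Comma.snd G (pt (l, k)))
  have : IsIso γ := inferInstanceAs (IsIso (𝟙 (Comma.snd G (pt (l, k)))))
  have hγ : (D.square γ).LeftBaseChange :=
    leftBaseChange_of_isEquivalence _ (D.isIso_square γ)
  refine LeftBaseChange.isIso_map
    (t := D.square (Comma.natTrans Q (pt ((l, ⟨⟨⟩⟩) : L × Pt.{w}))))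
    (fun _ a _ b => hD.der₄_left Q _ _ a _ b) ?_ adjF adjπ X
  refine D.leftBaseChange_vComp_square _ _ ?_
  refine hγ.of_vComp_left (D.leftBaseChange_vComp_square _ _ ?_)
  have h : (D.square (Comma.natTrans G (pt (l, k)))).LeftBaseChange :=
    fun _ a _ b => hD.der₄_left G (l, k) _ a _ b
  let c : Comma.fst G (pt (l, k)) ⋙ G ⟶ Comma.snd G (pt (l, k)) ⋙ pt (l, k) :=
    Functor.whiskerLeft (commaProdLeft F k l)
      (Functor.whiskerLeft (Comma.fst Q (pt ((l, ⟨⟨⟩⟩) : L × Pt.{w})))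
        (NatTrans.prod (𝟙 (𝟭 L)) (Comma.natTrans F (pt k))) ≫
          Functor.whiskerRight (Comma.natTrans Q (pt ((l, ⟨⟨⟩⟩) : L × Pt.{w})))
            ((𝟭 L).prod (pt k))) ≫
      Functor.whiskerRight γ (pt ((l, ⟨⟨⟩⟩) : L × Pt.{w}) ⋙ (𝟭 L).prod (pt k))
  -- The `L`-coordinate comes from the comma square of `Q`, the `K`-coordinate from that of `F`;
  -- every other factor is an identity.
  have hc : c = Comma.natTrans G (pt (l, k)) := by
    ext x
    · change (𝟙 _ ≫ x.hom.1) ≫ 𝟙 _ = x.hom.1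
      rw [Category.id_comp]
      exact Category.comp_id _
    · change (x.hom.2 ≫ 𝟙 _) ≫ 𝟙 _ = x.hom.2
      rw [Category.comp_id]
      exact Category.comp_id _
  rw [← hc] at h
  exact h

theorem IsDerivator.rightBaseChange_shift_comma (hD : D.IsDerivator) (L : Type w)
    [SmallCategory L] {rF : D.obj (L × J) ⥤ D.obj (L × K)} (adjF : D.map ((𝟭 L).prod F) ⊣ rF)
    {rπ : D.obj (L × Comma (pt k) F) ⥤ D.obj (L × Pt.{w})}
    (adjπ : D.map ((𝟭 L).prod (Comma.fst (pt k) F)) ⊣ rπ) (c : L × Pt.{w}) (X : D.obj (L × J)) :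
    IsIso ((D.map (pt c)).map ((mateEquiv adjF adjπ
      (D.square (P := (𝟭 L).prod (Comma.fst (pt k) F)) (F := (𝟭 L).prod (pt k))
        (Q := (𝟭 L).prod (Comma.snd (pt k) F)) (G := (𝟭 L).prod F)
        (NatTrans.prod (𝟙 (𝟭 L)) (Comma.natTrans (pt k) F)))).natTrans.app X)) := by
  obtain ⟨l, ⟨⟨⟩⟩⟩ := c
  let Q := (𝟭 L).prod (Comma.fst (pt k) F)
  let G := (𝟭 L).prod F
  have := hD.der₃_right (Comma.fst (pt ((l, ⟨⟨⟩⟩) : L × Pt.{w})) Q)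
  have := hD.der₃_right (Comma.fst (pt (l, k)) G)
  have : (D.map (commaProdRight F k l)).IsEquivalence :=
    D.isEquivalence_map (commaProdRight F k l).asEquivalence
  have : (D.map (𝟭 Pt.{w})).IsEquivalence :=
    D.isEquivalence_map (CategoryTheory.Equivalence.refl (C := Pt.{w}))
  let γ : Comma.fst (pt (l, k)) G ⋙ 𝟭 Pt.{w} ⟶
    commaProdRight F k l ⋙ Comma.fst (pt ((l, ⟨⟨⟩⟩) : L × Pt.{w})) Q :=
      𝟙 (Comma.fst (pt (l, k)) G)
  have : IsIso γ := inferInstanceAs (IsIso (𝟙 (Comma.fst (pt (l, k)) G)))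
  have hγ : (D.square γ).RightBaseChange :=
    rightBaseChange_of_isEquivalence _ (D.isIso_square γ)
  refine RightBaseChange.isIso_map
    (t := D.square (Comma.natTrans (pt ((l, ⟨⟨⟩⟩) : L × Pt.{w})) Q))
    (fun _ a _ b => hD.der₄_right Q _ _ a _ b) ?_ adjF adjπ X
  refine D.rightBaseChange_hComp_square _ _ ?_
  refine hγ.of_hComp_left (D.rightBaseChange_hComp_square _ _ ?_)
  have h : (D.square (Comma.natTrans (pt (l, k)) G)).RightBaseChange :=
    fun _ a _ b => hD.der₄_right G (l, k) _ a _ b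
  let c : Comma.fst (pt (l, k)) G ⋙ pt (l, k) ⟶ Comma.snd (pt (l, k)) G ⋙ G :=
    Functor.whiskerRight γ (pt ((l, ⟨⟨⟩⟩) : L × Pt.{w}) ⋙ (𝟭 L).prod (pt k)) ≫
      Functor.whiskerLeft (commaProdRight F k l)
        (Functor.whiskerRight (Comma.natTrans (pt ((l, ⟨⟨⟩⟩) : L × Pt.{w})) Q)
            ((𝟭 L).prod (pt k)) ≫
          Functor.whiskerLeft (Comma.snd (pt ((l, ⟨⟨⟩⟩) : L × Pt.{w})) Q)
            (NatTrans.prod (𝟙 (𝟭 L)) (Comma.natTrans (pt k) F)))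
  have hc : c = Comma.natTrans (pt (l, k)) G := by
    ext x
    · change 𝟙 _ ≫ x.hom.1 ≫ 𝟙 _ = x.hom.1
      rw [Category.comp_id]
      exact Category.id_comp _
    · change 𝟙 _ ≫ 𝟙 _ ≫ x.hom.2 = x.hom.2
      rw [Category.id_comp]
      exact Category.id_comp _
  rw [← hc] at h
  exact h

/-- Every shift of a derivator is a derivator. -/
theorem IsDerivator.shift (hD : D.IsDerivator) (L : Type w) [SmallCategory L] :
    (D.shift L).IsDerivator where
  der₁ {ι} I _ := by
    have : (D.map (sigmaProd L I)).IsEquivalence :=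
      D.isEquivalence_map (sigmaProd L I).asEquivalence
    have : (Functor.pi' fun i =>
        D.map (Sigma.incl (C := fun i => L × I i) i)).IsEquivalence :=
      hD.der₁ fun i => L × I i
    have e : D.map (sigmaProd L I) ⋙
          Functor.pi' (fun i => D.map (Sigma.incl (C := fun i => L × I i) i)) ≅
        Functor.pi' (fun i => D.map ((𝟭 L).prod (Sigma.incl (C := I) i))) :=
      NatIso.pi' fun i =>
        eqToIso (D.map_comp (Sigma.incl (C := fun i => L × I i) i) (sigmaProd L I)).symm
    have := Functor.isEquivalence_trans (D.map (sigmaProd L I)) (Functor.pi' fun i =>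
        D.map (Sigma.incl (C := fun i => L × I i) i))
    exact @Functor.isEquivalence_of_iso _ _ _ _ _ _ e this
  der₂ {J} _ {X Y} f h := by
    -- Restriction to `(l, j)` factors through restriction along `L × j`, where `h` applies.
    refine hD.der₂ (J := L × J) f fun ⟨l, j⟩ => ?_
    have e : D.map ((𝟭 L).prod (pt j)) ⋙ D.map (pt ((l, ⟨⟨⟩⟩) : L × Pt.{w})) ≅
        D.map (pt (l, j)) :=
      eqToIso (D.map_comp (pt ((l, ⟨⟨⟩⟩) : L × Pt.{w})) ((𝟭 L).prod (pt j))).symm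
    refine (NatIso.isIso_map_iff e f).1 ?_
    have : IsIso ((D.map ((𝟭 L).prod (pt j))).map f) := h j
    exact inferInstanceAs (IsIso ((D.map (pt ((l, ⟨⟨⟩⟩) : L × Pt.{w}))).map
      ((D.map ((𝟭 L).prod (pt j))).map f)))
  der₃_left F := hD.der₃_left ((𝟭 L).prod F)
  der₃_right F := hD.der₃_right ((𝟭 L).prod F)
  der₄_left F k lF adjF lπ adjπ := by
    rw [NatTrans.isIso_iff_isIso_app]
    intro X
    exact hD.der₂ _ fun c => hD.leftBaseChange_shift_comma F k L adjF adjπ c X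
  der₄_right F k rF adjF rπ adjπ := by
    rw [NatTrans.isIso_iff_isIso_app]
    intro X
    exact hD.der₂ _ fun c => hD.rightBaseChange_shift_comma F k L adjF adjπ c X

end
end Prederivator

/-! ### Strict isomorphisms. -/

namespace Prederivator

section

variable {D D' : Prederivator.{w, v, u}}

theorem map₂_app_congr (D : Prederivator.{w, v, u}) {I J : Type w} [SmallCategory I]
    [SmallCategory J] {F G : I ⥤ J} (α : F ⟶ G) {X Y : D.obj J} (h : X = Y) :
    (D.map₂ α).app X = eqToHom (by rw [h]) ≫ (D.map₂ α).app Y ≫ eqToHom (by rw [h]) := by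
  subst h
  simp

/-- The inverse of a strict morphism all of whose values are isomorphisms of categories. -/
def StrictHom.inverse (φ : StrictHom D D')
    (ψ : ∀ (I : Type w) [SmallCategory I], D'.obj I ⥤ D.obj I)
    (h₁ : ∀ (I : Type w) [SmallCategory I], φ.app I ⋙ ψ I = 𝟭 _)
    (h₂ : ∀ (I : Type w) [SmallCategory I], ψ I ⋙ φ.app I = 𝟭 _) : StrictHom D' D where
  app I _ := ψ I
  naturality {I J} _ _ F := by
    calc D'.map F ⋙ ψ I = (ψ J ⋙ φ.app J) ⋙ D'.map F ⋙ ψ I := by rw [h₂]; rfl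
      _ = ψ J ⋙ (φ.app J ⋙ D'.map F) ⋙ ψ I := rfl
      _ = ψ J ⋙ (D.map F ⋙ φ.app I) ⋙ ψ I := by rw [φ.naturality]
      _ = (ψ J ⋙ D.map F) ⋙ (φ.app I ⋙ ψ I) := rfl
      _ = ψ J ⋙ D.map F := by rw [h₁]; rfl
  naturality₂ {I J} _ _ F G α := by
    ext X
    -- Faithfulness lets the 2-cell identity be checked after applying `φ`, where `map₂_map` moves
    -- both sides to `D'`.
    have : (φ.app I).Faithful := by
      have : (φ.app I ⋙ ψ I).Faithful := by rw [h₁]; infer_instance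
      exact Functor.Faithful.of_comp _ (ψ I)
    apply (φ.app I).map_injective
    have e : (φ.app J).obj ((ψ J).obj X) = X := Functor.congr_obj (h₂ J) X
    have e' := Functor.congr_hom (h₂ I) ((D'.map₂ α).app X)
    simp only [Functor.comp_map, Functor.id_map] at e'
    simp [eqToHom_app, eqToHom_map, φ.map₂_map, e', D'.map₂_app_congr α e]

theorem isIso_of_app (φ : D ⟶ D')
    (ψ : ∀ (I : Type w) [SmallCategory I], D'.obj I ⥤ D.obj I)
    (h₁ : ∀ (I : Type w) [SmallCategory I], StrictHom.app φ I ⋙ ψ I = 𝟭 _)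
    (h₂ : ∀ (I : Type w) [SmallCategory I], ψ I ⋙ StrictHom.app φ I = 𝟭 _) : IsIso φ :=
  ⟨StrictHom.inverse φ ψ h₁ h₂, StrictHom.ext (funext fun I => funext fun _ => h₁ I),
    StrictHom.ext (funext fun I => funext fun _ => h₂ I)⟩

/-- Both composites equal identities, so zigzags of length zero suffice. -/
theorem isStrongEquivalence_of_isIso (φ : D ⟶ D') [IsIso φ] : IsStrongEquivalence φ := by
  refine ⟨inv φ, ?_, ?_⟩
  · rw [IsIso.hom_inv_id]
    exact Relation.EqvGen.refl _
  · rw [IsIso.inv_hom_id]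
    exact Relation.EqvGen.refl _

theorem isEquivalence_app (φ : D ⟶ D') [IsIso φ] (I : Type w) [SmallCategory I] :
    (StrictHom.app φ I).IsEquivalence := by
  have h₁ : StrictHom.app φ I ⋙ StrictHom.app (inv φ) I = 𝟭 _ :=
    congrArg (fun t => StrictHom.app t I) (IsIso.hom_inv_id φ)
  have h₂ : StrictHom.app (inv φ) I ⋙ StrictHom.app φ I = 𝟭 _ :=
    congrArg (fun t => StrictHom.app t I) (IsIso.inv_hom_id φ)
  exact (CategoryTheory.Equivalence.mk (StrictHom.app φ I) (StrictHom.app (inv φ) I)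
    (eqToIso h₁.symm) (eqToIso h₂)).isEquivalence_functor

end

end Prederivator

/-! ### The exponential law on localizations. -/

section Exponential

variable {M : Type u} [Category.{w} M] (W : MorphismProperty M) (L : Type w) [SmallCategory L]

/-- The inverse of the exponential law. -/
def expLawInv (L I : Type w) [SmallCategory L] [SmallCategory I] (M : Type u) [Category.{v} M] :
    (L × I ⥤ M) ⥤ (I ⥤ L ⥤ M) :=
  Functor.curry ⋙ flipFunctor L I M

/-- Equality of functors, not just an isomorphism, is what makes the induced morphism of
prederivators strictly invertible. -/
theorem expLaw_comp_expLawInv (I : Type w) [SmallCategory I] :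
    expLaw L I M ⋙ expLawInv L I M = 𝟭 _ := by
  refine CategoryTheory.Functor.ext (fun X => ?_) ?_
  · exact congrArg (fun t => t.flip) (Functor.curry_obj_uncurry_obj X.flip)
  · intro X Y f
    ext i l
    simp [expLaw, expLawInv]
    erw [eqToHom_app, eqToHom_app, eqToHom_refl]
    exact (Category.comp_id _).symm

theorem expLawInv_comp_expLaw (I : Type w) [SmallCategory I] :
    expLawInv L I M ⋙ expLaw L I M = 𝟭 _ := by
  refine CategoryTheory.Functor.ext (fun X => ?_) ?_
  · exact Functor.uncurry_obj_curry_obj X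
  · intro X Y f
    ext ⟨l, i⟩
    simp [expLaw, expLawInv]
    erw [eqToHom_app, eqToHom_refl]
    exact (Category.comp_id _).symm

/-- The exponential law on localizations. -/
noncomputable def hoExp (I : Type w) [SmallCategory I] :
    ((W.functorCategory L).functorCategory I).Localization ⥤
      (W.functorCategory (L × I)).Localization :=
  Localization.Construction.lift (expLaw L I M ⋙ (W.functorCategory (L × I)).Q)
    (fun _ _ f hf => (W.functorCategory (L × I)).Q_inverts ((expLaw L I M).map f)
      (fun x => hf x.2 x.1))

theorem Q_hoExp (I : Type w) [SmallCategory I] :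
    ((W.functorCategory L).functorCategory I).Q ⋙ hoExp W L I =
      expLaw L I M ⋙ (W.functorCategory (L × I)).Q :=
  Localization.Construction.fac _ _

/-- The inverse exponential law on localizations. -/
noncomputable def hoExpInv (I : Type w) [SmallCategory I] :
    (W.functorCategory (L × I)).Localization ⥤
      ((W.functorCategory L).functorCategory I).Localization :=
  Localization.Construction.lift
    (expLawInv L I M ⋙ ((W.functorCategory L).functorCategory I).Q)
    (fun _ _ f hf => ((W.functorCategory L).functorCategory I).Q_inverts ((expLawInv L I M).map f)
      (fun i l => hf (l, i)))

theorem Q_hoExpInv (I : Type w) [SmallCategory I] :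
    (W.functorCategory (L × I)).Q ⋙ hoExpInv W L I =
      expLawInv L I M ⋙ ((W.functorCategory L).functorCategory I).Q :=
  Localization.Construction.fac _ _

theorem hoExp_comp_hoExpInv (I : Type w) [SmallCategory I] :
    hoExp W L I ⋙ hoExpInv W L I = 𝟭 _ := by
  apply Localization.Construction.uniq
  rw [← Functor.assoc, Q_hoExp, Functor.assoc, Q_hoExpInv, ← Functor.assoc,
    expLaw_comp_expLawInv]
  rfl

theorem hoExpInv_comp_hoExp (I : Type w) [SmallCategory I] :
    hoExpInv W L I ⋙ hoExp W L I = 𝟭 _ := by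
  apply Localization.Construction.uniq
  rw [← Functor.assoc, Q_hoExpInv, Functor.assoc, Q_hoExp, ← Functor.assoc,
    expLawInv_comp_expLaw]
  rfl

theorem hoExp_map_Q {I : Type w} [SmallCategory I] {X Y : I ⥤ L ⥤ M} (f : X ⟶ Y) :
    (hoExp W L I).map (((W.functorCategory L).functorCategory I).Q.map f) =
      (W.functorCategory (L × I)).Q.map ((expLaw L I M).map f) := by
  have h := Functor.congr_hom (Q_hoExp W L I) f
  refine h.trans ?_
  erw [eqToHom_refl, eqToHom_refl, Category.id_comp, Category.comp_id]
  rfl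

/-- Leaves the object equalities to the caller: at objects in the image of `Q` the endpoints agree
definitionally, so both `eqToHom` become identities. -/
theorem eqToHom_conj_app_of_obj_eq {C : Type u₁} [Category.{v₁} C] {E : Type u₂} [Category.{v₂} E]
    {F F' G G' : C ⥤ E} (hF : F = F') (α : F' ⟶ G') (hG : G' = G) (X : C)
    (hFX : F.obj X = F'.obj X) (hGX : G'.obj X = G.obj X) :
    (eqToHom hF ≫ α ≫ eqToHom hG).app X = eqToHom hFX ≫ α.app X ≫ eqToHom hGX := by
  simp [eqToHom_app]

theorem hoMap_comp_hoExp {I J : Type w} [SmallCategory I] [SmallCategory J] (F : I ⥤ J) :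
    hoMap (W.functorCategory L) F ⋙ hoExp W L I = hoExp W L J ⋙ hoMap W ((𝟭 L).prod F) := by
  apply Localization.Construction.uniq
  rw [← Functor.assoc, ← Functor.assoc, Q_hoMap, Functor.assoc, Q_hoExp, Q_hoExp, Functor.assoc,
    Q_hoMap]
  rfl

theorem whiskerRight_hoMap₂_hoExp {I J : Type w} [SmallCategory I] [SmallCategory J]
    {F G : I ⥤ J} (α : F ⟶ G) :
    Functor.whiskerRight (hoMap₂ (W.functorCategory L) α) (hoExp W L I) =
      eqToHom (hoMap_comp_hoExp W L F) ≫
        Functor.whiskerLeft (hoExp W L J) (hoMap₂ W (NatTrans.prod (𝟙 (𝟭 L)) α)) ≫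
          eqToHom (hoMap_comp_hoExp W L G).symm := by
  apply natTrans_ext_Q
  intro X
  refine Eq.trans ?_ (eqToHom_conj_app_of_obj_eq (hoMap_comp_hoExp W L F) _
    (hoMap_comp_hoExp W L G).symm _ (Functor.congr_obj (hoMap_comp_hoExp W L F) _)
    (Functor.congr_obj (hoMap_comp_hoExp W L G).symm _)).symm
  refine Eq.trans ?_ ((Category.id_comp _).trans (Category.comp_id _)).symm
  change (hoExp W L I).map ((hoMap₂ (W.functorCategory L) α).app
      (((W.functorCategory L).functorCategory J).Q.obj X)) =
    (hoMap₂ W (NatTrans.prod (𝟙 (𝟭 L)) α)).app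
      ((W.functorCategory (L × J)).Q.obj ((expLaw L J M).obj X))
  rw [hoMap₂_app_Q, hoMap₂_app_Q]
  refine (hoExp_map_Q W L (Functor.whiskerRight α X)).trans ?_
  -- Both sides are now images under `Q` of transformations of actual diagrams, which can be
  -- compared objectwise.
  refine congrArg (W.functorCategory (L × I)).Q.map ?_
  ext ⟨l, i⟩
  simp [expLaw]

/-- The canonical strict morphism from the prederivator of `M^L` to the shift of that of `M`. -/
noncomputable def HO.exp : HO (W.functorCategory L) ⟶ (HO W).shift L where
  app I _ := hoExp W L I
  naturality F := hoMap_comp_hoExp W L F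
  naturality₂ α := whiskerRight_hoMap₂_hoExp W L α

instance : IsIso (HO.exp W L) :=
  Prederivator.isIso_of_app _ (fun I _ => hoExpInv W L I) (fun I _ => hoExp_comp_hoExpInv W L I)
    (fun I _ => hoExpInv_comp_hoExp W L I)

variable {W} in
theorem InducesDerivator.functorCategory (hW : InducesDerivator W) :
    InducesDerivator (W.functorCategory L) where
  locallySmall I _ := by
    have := hW.locallySmall (L × I)
    have : (hoExp W L I).IsEquivalence := Prederivator.isEquivalence_app (HO.exp W L) I
    exact locallySmall_of_faithful (hoExp W L I)
  -- The axioms are known for the shift, so transport runs along the inverse of the canonical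
  -- morphism.
  isDerivator := Prederivator.StrictHom.isDerivator (inv (HO.exp W L))
    (fun I _ => Prederivator.isEquivalence_app (inv (HO.exp W L)) I) (hW.isDerivator.shift L)

end Exponential

theorem mainTheorem2 {M : Type u} [Category.{w} M] (W : MorphismProperty M)
    (L : Type w) [SmallCategory L] (hW : InducesDerivator W) :
    InducesDerivator (W.functorCategory L) ∧
    ((HO W).shift L).IsDerivator ∧
    ∃ φ : HO (W.functorCategory L) ⟶ (HO W).shift L,
      (∀ (I : Type w) [SmallCategory I],
        (HO.Q (W.functorCategory L) I ⋙ Prederivator.StrictHom.app φ I :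
            (I ⥤ L ⥤ M) ⥤ (HO W).obj (L × I)) =
          expLaw L I M ⋙ HO.Q W (L × I)) ∧
      IsIso φ ∧
      Prederivator.IsStrongEquivalence φ :=
  ⟨hW.functorCategory L, hW.isDerivator.shift L, HO.exp W L, fun I _ => Q_hoExp W L I,
    inferInstance, Prederivator.isStrongEquivalence_of_isIso _⟩
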